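/- Let $p\in(1,\infty)$. There is a constant $C_p<\infty$, depending only on $p$, with the following property. Let $X$ be an infinite countable set, $m:X\to(0,\infty)$, $c:X\to\mathbb R$, and let $b$ be a connected graph over $X$, i.e. $b:X\times X\to[0,\infty)$ is symmetric, vanishes on the diagonal, satisfies $\sum_{y}b(x,y)<\infty$ for every $x\in X$, and any two points of $X$ are joined by a finite path $x_0,\dots,x_n$ with $b(x_{i},x_{i+1})>0$ (local finiteness is not assumed). Let $C_c(X)$ be the set of finitely supported real functions on $X$, and assume that $$Q(\varphi)=\tfrac12\sum_{x,y\in X}b(x,y)|\varphi(x)-\varphi(y)|^p+\sum_{x\in X}c(x)|\varphi(x)|^p$$ satisfies $Q(\varphi)\ge 0$ for all $\varphi\in C_c(X)$. Let $g:X\to\mathbb R$ be any function, and let $u:X\to(0,\infty)$ be a strictly positive supersolution of the $p$-Schrödinger equation, i.e. for every $x\in X$ one has $\sum_{y}b(x,y)|u(x)-u(y)|^{p-1}<\infty$ and $$\frac1{m(x)}\sum_{y\in X}b(x,y)|u(x)-u(y)|^{p-2}(u(x)-u(y))+\frac{c(x)}{m(x)}|u(x)|^{p-2}u(x)\ge 0$$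 (with $|0|^{p-2}\cdot 0=0$). Then $$\|g\|_{\mathcal H,u}\le\|g\|_{\mathcal H}\le C_p\,\|g\|_{\mathcal H,u}\qquad\text{in }[0,\infty].$$ Here $\|g\|_{\mathcal H}=1/C(g)\in[0,\infty]$, where $C(g)\in[0,\infty]$ is the supremum of all $C\ge0$ with $C\sum_{X}m|g||\varphi|^p\le Q(\varphi)$ for all $\varphi\in C_c(X)$ (with $1/0=\infty$, $1/\infty=0$), and $$\|g\|_{\mathcal H,u}=\sup_{K\subseteq X\text{ finite}}\frac{\sum_{x\in K}m(x)u(x)^p|g(x)|}{\mathrm{Cap}_u(K)},\qquad \mathrm{Cap}_u(K)=\inf\{Q(\varphi):\varphi\in C_c(X),\ \varphi\ge 1_Ku\},$$ where the quotients are taken in $[0,\infty]$ with $0/0=0$ and $a/0=\infty$ for $a>0$. -/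

import Mathlib

open scoped ENNReal NNReal

noncomputable section

namespace HardyGraph

/-- A connected (not necessarily locally finite) weighted graph `b` on the vertex set `X`:
a symmetric function `b : X × X → [0, ∞)` with zero diagonal and `∑_y b(x, y) < ∞` for all `x`,
such that any two vertices are joined by a path of edges of strictly positive weight. -/
structure ConnectedGraph (X : Type*) where
  b : X → X → ℝ
  nonneg : ∀ x y, 0 ≤ b x y
  symm : ∀ x y, b x y = b y x
  diag : ∀ x, b x x = 0
  summable : ∀ x, Summable (fun y => b x y)
  connected : ∀ x y, Relation.ReflTransGen (fun v w => 0 < b v w) x y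

variable {X : Type*}

/-- The energy functional
`Q(φ) = 1/2 ∑_{x,y} b(x,y) |φ(x) - φ(y)|^p + ∑_x c(x) |φ(x)|^p`, used for `φ` of finite support
(where both series converge absolutely). -/
def energy (p : ℝ) (G : ConnectedGraph X) (c : X → ℝ) (φ : X → ℝ) : ℝ :=
  (1 / 2) * ∑' z : X × X, G.b z.1 z.2 * |φ z.1 - φ z.2| ^ p + ∑' x, c x * |φ x| ^ p

/-- `Q ≥ 0` on the finitely supported functions. -/
def EnergyNonneg (p : ℝ) (G : ConnectedGraph X) (c : X → ℝ) : Prop :=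
  ∀ φ : X → ℝ, φ.support.Finite → 0 ≤ energy p G c φ

/-- The space `F(X)` of all `f` with `∑_y b(x,y) |f(x) - f(y)|^(p-1) < ∞` for all `x`. -/
def MemF (p : ℝ) (G : ConnectedGraph X) (f : X → ℝ) : Prop :=
  ∀ x, Summable (fun y => G.b x y * |f x - f y| ^ (p - 1))

/-- The weighted `p`-Laplacian
`L f(x) = (1/m(x)) ∑_y b(x,y) |f(x) - f(y)|^(p-2) (f(x) - f(y))`, for `f` in `F(X)`. -/
def pLaplacian (p : ℝ) (G : ConnectedGraph X) (m : X → ℝ) (f : X → ℝ) (x : X) : ℝ :=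
  (1 / m x) * ∑' y, G.b x y * (|f x - f y| ^ (p - 2) * (f x - f y))

/-- The `p`-Schrödinger operator `L f + (c/m) |f|^(p-2) f`. -/
def pSchrodinger (p : ℝ) (G : ConnectedGraph X) (m c : X → ℝ) (f : X → ℝ) (x : X) : ℝ :=
  pLaplacian p G m f x + c x / m x * (|f x| ^ (p - 2) * f x)

/-- `u` is a supersolution on `X` of the `p`-Schrödinger equation. -/
def IsSupersolution (p : ℝ) (G : ConnectedGraph X) (m c : X → ℝ) (u : X → ℝ) : Prop :=
  MemF p G u ∧ ∀ x, 0 ≤ pSchrodinger p G m c u x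

/-- The `Q`-capacity of the finite set `K` with respect to `u`: the infimum of `Q(φ)` over all
finitely supported `φ` with `φ ≥ 1_K u` on `X`. -/
def capacity (p : ℝ) (G : ConnectedGraph X) (c : X → ℝ) (u : X → ℝ) (K : Finset X) : ℝ :=
  sInf (energy p G c ''
    {φ : X → ℝ | φ.support.Finite ∧ ∀ x, Set.indicator (K : Set X) u x ≤ φ x})

/-- The Hardy constant of `g`: the best constant `C ∈ [0, ∞]` in the Hardy inequality
`C ∑_X m |g| |φ|^p ≤ Q(φ)` for all finitely supported `φ`. It is `∞` for `g = 0`, and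
it is positive if and only if `g` is a Hardy weight. -/
def hardyConst (p : ℝ) (G : ConnectedGraph X) (m c : X → ℝ) (g : X → ℝ) : ℝ≥0∞ :=
  ⨆ (C : ℝ≥0) (_ : ∀ φ : X → ℝ, φ.support.Finite →
      (C : ℝ) * ∑' x, m x * |g x| * |φ x| ^ p ≤ energy p G c φ), (C : ℝ≥0∞)

/-- The norm `‖g‖_H ∈ [0, ∞]`: the reciprocal of the Hardy constant of `g`. -/
def hardyNorm (p : ℝ) (G : ConnectedGraph X) (m c : X → ℝ) (g : X → ℝ) : ℝ≥0∞ :=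
  (hardyConst p G m c g)⁻¹

/-- The norm `‖g‖_{H,u} ∈ [0, ∞]`: the supremum over the finite sets `K` of
`(∑_K m u^p |g|) / Cap_u(K)`. The quotient is taken in `[0, ∞]`, so `0 / 0 = 0` and
`a / 0 = ∞` for `a > 0`. -/
def capacityNorm (p : ℝ) (G : ConnectedGraph X) (m c : X → ℝ) (u g : X → ℝ) : ℝ≥0∞ :=
  ⨆ K : Finset X,
    ENNReal.ofReal (∑ x ∈ K, m x * u x ^ p * |g x|) / ENNReal.ofReal (capacity p G c u K)

end HardyGraph

end

/-!
The first inequality is the admissibility of the test functions: if `φ ≥ 1_K u`, a Hardy inequality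
for `φ` bounds the `g`-measure `∑_K m u^p |g|` by the energy of `φ`.

The second one is a strong capacitary inequality. Write a nonnegative finitely supported function
as `φ = u ψ`. Testing the `p`-Schrödinger operator of `u` with `u ψ^p` gives the ground
state representation `energy_mul_eq`: the energy of `u ψ` is half the sum over the edges of `b`
times the gap `piconeGap` in the discrete Picone inequality, plus a sum of `ψ^p` against a potential
which is nonnegative because `u` is a supersolution. So all terms are nonnegative, and comparing
energies reduces to inequalities between real numbers on single edges.

For `p < 2` the truncations `min (max (ψ - l) 0) l` usual in such arguments are not good enough,
since the gap is not controlled where they vanish to first order. The truncation used here is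
`sqTrunc l ψ = l min(ψ / l, 1)^2`. The derivative of the gap in the ratio `z` of the values at the
two ends of an edge shows that the gap decreases in `z ∈ [0, 1]` (`antitoneOn_piconeGap`), and
that replacing `z` by `z^2` costs a constant (`exists_piconeGap_sq_bound`); the latter rests on
comparing increments of `|x|^(p-2) x` at a point and at a contracted point
(`exists_oddPow_contract_bound`). Hence the gap of `sqTrunc l ψ` is at most a constant times
`min(r, 1/r)` times that of `ψ`, where `r` is the larger value of `ψ` divided by `l`. These factors
have a bounded sum over the dyadic levels `l` (`sum_scaleWeight_le`), so the energies of all dyadic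
truncations of `u ψ` add up to a multiple of the energy of `u ψ` (`sum_energy_sqTrunc_le`). Each of
them is admissible, up to scaling, for the capacity of the level set `{ψ ≥ l}`, and the layer cake
decomposition of `ψ^p` gives the Hardy inequality (`hardy_of_capacity`).
-/

open scoped ENNReal NNReal

namespace HardyGraph

/-! ### Increments of the odd power -/

/-- The odd power `h(x) = |x|^(p-2) x`. -/
noncomputable def oddPow (p x : ℝ) : ℝ := |x| ^ (p - 2) * x

section OddPow

variable {p : ℝ}

lemma oddPow_zero : oddPow p 0 = 0 := by simp [oddPow]

lemma oddPow_neg (x : ℝ) : oddPow p (-x) = -oddPow p x := by simp [oddPow]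

lemma oddPow_of_pos {x : ℝ} (hx : 0 < x) : oddPow p x = x ^ (p - 1) := by
  rw [oddPow, abs_of_pos hx, ← Real.rpow_add_one hx.ne']
  congr 1; ring

lemma oddPow_of_nonneg (hp : 1 < p) {x : ℝ} (hx : 0 ≤ x) : oddPow p x = x ^ (p - 1) := by
  rcases hx.eq_or_lt with rfl | hx
  · rw [oddPow_zero, Real.zero_rpow (by linarith)]
  · exact oddPow_of_pos hx

lemma oddPow_mul {v : ℝ} (hp : 1 < p) (hv : 0 ≤ v) (x : ℝ) :
    oddPow p (v * x) = v ^ (p - 1) * oddPow p x := by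
  rw [← oddPow_of_nonneg hp hv, oddPow, oddPow, oddPow, abs_mul,
    Real.mul_rpow (abs_nonneg _) (abs_nonneg _)]
  ring

lemma oddPow_mul_self (hp : 1 < p) (x : ℝ) : oddPow p x * x = |x| ^ p := by
  rcases eq_or_ne x 0 with rfl | hx
  · simp [oddPow_zero, Real.zero_rpow (by linarith : p ≠ 0)]
  · have h : 0 < |x| := abs_pos.2 hx
    rw [oddPow, mul_assoc, ← abs_mul_abs_self, ← mul_assoc, ← Real.rpow_add_one h.ne',
      ← Real.rpow_add_one h.ne']
    congr 1; ring

lemma abs_oddPow (hp : 1 < p) (x : ℝ) : |oddPow p x| = |x| ^ (p - 1) := by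
  rw [← oddPow_of_nonneg hp (abs_nonneg x), oddPow, oddPow, abs_mul, abs_abs,
    abs_of_nonneg (Real.rpow_nonneg (abs_nonneg x) _)]

lemma strictMono_oddPow (hp : 1 < p) : StrictMono (oddPow p) := by
  have key : ∀ x y : ℝ, 0 ≤ x → x < y → oddPow p x < oddPow p y := fun x y hx hxy => by
    rw [oddPow_of_nonneg hp hx, oddPow_of_nonneg hp (hx.trans hxy.le)]
    exact Real.rpow_lt_rpow hx hxy (by linarith)
  intro x y hxy
  rcases le_or_gt 0 x with hx | hx
  · exact key x y hx hxy
  · rcases le_or_gt y 0 with hy | hy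
    · have := key (-y) (-x) (by linarith) (by linarith)
      rw [oddPow_neg, oddPow_neg] at this
      linarith
    · have h1 := key 0 y le_rfl hy
      have h2 := key 0 (-x) le_rfl (by linarith)
      rw [oddPow_neg] at h2
      rw [oddPow_zero] at h1 h2
      linarith

lemma continuous_oddPow (hp : 1 < p) : Continuous (oddPow p) := by
  have : oddPow p = fun x => max x 0 ^ (p - 1) - max (-x) 0 ^ (p - 1) := by
    funext x
    have h0 : (0 : ℝ) ^ (p - 1) = 0 := Real.zero_rpow (by linarith)
    rcases le_total 0 x with hx | hx
    · rw [oddPow_of_nonneg hp hx, max_eq_left hx, max_eq_right (by linarith), h0, sub_zero]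
    · rw [max_eq_right hx, max_eq_left (by linarith), h0, ← oddPow_of_nonneg hp (by linarith),
        oddPow_neg]
      ring
  rw [this]
  exact ((continuous_id.max continuous_const).rpow_const fun _ => Or.inr (by linarith)).sub
    ((continuous_neg.max continuous_const).rpow_const fun _ => Or.inr (by linarith))

lemma rpow_le_two_rpow_abs_mul {x y q : ℝ} (hx : 0 < x) (hy : 0 < y) (h1 : x ≤ 2 * y)
    (h2 : y ≤ 2 * x) : x ^ q ≤ 2 ^ |q| * y ^ q := by
  rcases le_total 0 q with hq | hq
  · rw [abs_of_nonneg hq, ← Real.mul_rpow zero_le_two hy.le]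
    exact Real.rpow_le_rpow hx.le h1 hq
  · have : (2 * x) ^ q ≤ y ^ q := Real.rpow_le_rpow_of_nonpos hy h2 hq
    rw [Real.mul_rpow zero_le_two hx.le] at this
    rw [abs_of_nonpos hq, Real.rpow_neg zero_le_two, inv_mul_eq_div, le_div_iff₀' (by positivity)]
    exact this

/-- Two-sided estimate of the unit increments of the odd power. On `[-2, 1]` it holds by
compactness, for `y ≥ 1` by the mean value theorem, and for `y ≤ -2` by reflection at `-1/2`. -/
lemma exists_oddPow_increment_bounds (hp : 1 < p) : ∃ K : ℝ, 0 < K ∧ ∀ y : ℝ,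
    oddPow p (y + 1) - oddPow p y ≤ K * (1 + |y|) ^ (p - 2) ∧
    (1 + |y|) ^ (p - 2) ≤ K * (oddPow p (y + 1) - oddPow p y) := by
  have hpos : ∀ y : ℝ, 0 < oddPow p (y + 1) - oddPow p y := fun y =>
    sub_pos.2 (strictMono_oddPow hp (lt_add_one y))
  have hw : ∀ y : ℝ, 0 < (1 + |y|) ^ (p - 2) := fun y => by positivity
  have hc := continuous_oddPow hp
  have hcU : Continuous fun y : ℝ => oddPow p (y + 1) - oddPow p y := by fun_prop
  have hcw : Continuous fun y : ℝ => (1 + |y|) ^ (p - 2) :=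
    (by fun_prop : Continuous fun y : ℝ => 1 + |y|).rpow_const fun y => Or.inl (by positivity)
  obtain ⟨K₁, hK₁⟩ := (isCompact_Icc (a := (-2 : ℝ)) (b := 1)).exists_bound_of_continuousOn
    (hcU.div hcw fun y => (hw y).ne').continuousOn
  obtain ⟨K₂, hK₂⟩ := (isCompact_Icc (a := (-2 : ℝ)) (b := 1)).exists_bound_of_continuousOn
    (hcw.div hcU fun y => (hpos y).ne').continuousOn
  have hq : 0 < p - 1 := by linarith
  set T : ℝ := 2 ^ |p - 2| with hT
  have hT0 : 0 < T := by positivity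
  have right : ∀ y : ℝ, 1 ≤ y → oddPow p (y + 1) - oddPow p y ≤ (p - 1) * T * (1 + |y|) ^ (p - 2) ∧
      (1 + |y|) ^ (p - 2) ≤ T / (p - 1) * (oddPow p (y + 1) - oddPow p y) := fun y hy => by
    obtain ⟨ξ, ⟨h1, h2⟩, hξ⟩ := exists_hasDerivAt_eq_slope (fun x : ℝ => x ^ (p - 1))
      (fun x => (p - 1) * x ^ (p - 1 - 1)) (lt_add_one y)
      (continuousOn_id.rpow_const fun x _ => Or.inr hq.le)
      (fun x hx => Real.hasDerivAt_rpow_const (Or.inl (by linarith [hx.1])))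
    rw [oddPow_of_pos (by linarith), oddPow_of_pos (by linarith), abs_of_pos (by linarith)]
    rw [add_sub_cancel_left, div_one, show p - 1 - 1 = p - 2 by ring] at hξ
    rw [← hξ]
    constructor
    · rw [mul_assoc]
      exact mul_le_mul_of_nonneg_left (rpow_le_two_rpow_abs_mul (by linarith) (by linarith)
        (by linarith) (by linarith)) hq.le
    · rw [← mul_assoc, div_mul_cancel₀ _ hq.ne']
      exact rpow_le_two_rpow_abs_mul (by linarith) (by linarith) (by linarith) (by linarith)
  have reflect : ∀ y : ℝ, oddPow p (y + 1) - oddPow p y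
      = oddPow p ((-1 - y) + 1) - oddPow p (-1 - y) := fun y => by
    rw [show (-1 - y) + 1 = -y by ring, show -1 - y = -(y + 1) by ring, oddPow_neg, oddPow_neg]
    ring
  refine ⟨|K₁| + |K₂| + ((p - 1) * T * T + T / (p - 1) * T + (p - 1) * T + T / (p - 1)),
    by positivity, fun y => ?_⟩
  suffices h : ∃ A B : ℝ, A ≤ |K₁| + |K₂| +
      ((p - 1) * T * T + T / (p - 1) * T + (p - 1) * T + T / (p - 1)) ∧
      B ≤ |K₁| + |K₂| + ((p - 1) * T * T + T / (p - 1) * T + (p - 1) * T + T / (p - 1)) ∧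
      oddPow p (y + 1) - oddPow p y ≤ A * (1 + |y|) ^ (p - 2) ∧
      (1 + |y|) ^ (p - 2) ≤ B * (oddPow p (y + 1) - oddPow p y) by
    obtain ⟨A, B, hA, hB, h1, h2⟩ := h
    exact ⟨h1.trans (mul_le_mul_of_nonneg_right hA (hw y).le),
      h2.trans (mul_le_mul_of_nonneg_right hB (hpos y).le)⟩
  have e1 : 0 < (p - 1) * T * T := by positivity
  have e2 : 0 < T / (p - 1) * T := by positivity
  have e3 : 0 < (p - 1) * T := by positivity
  have e4 : 0 < T / (p - 1) := by positivity
  have a1 := abs_nonneg K₁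
  have a2 := abs_nonneg K₂
  rcases le_or_gt 1 y with hy | hy
  · exact ⟨(p - 1) * T, T / (p - 1), by linarith, by linarith, right y hy⟩
  rcases le_or_gt (-2) y with hy' | hy'
  · refine ⟨K₁, K₂, by linarith [le_abs_self K₁], by linarith [le_abs_self K₂], ?_, ?_⟩
    · rw [← div_le_iff₀ (hw y)]
      exact (le_abs_self _).trans (hK₁ y ⟨hy', hy.le⟩)
    · rw [← div_le_iff₀ (hpos y)]
      exact (le_abs_self _).trans (hK₂ y ⟨hy', hy.le⟩)
  · obtain ⟨h1, h2⟩ := right (-1 - y) (by linarith)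
    rw [reflect y]
    have hay : |y| = -y := abs_of_neg (by linarith)
    have hay' : |-1 - y| = -1 - y := abs_of_pos (by linarith)
    refine ⟨(p - 1) * T * T, T / (p - 1) * T, by linarith, by linarith, ?_, ?_⟩
    · refine h1.trans ?_
      rw [mul_assoc ((p - 1) * T)]
      refine mul_le_mul_of_nonneg_left ?_ e3.le
      exact rpow_le_two_rpow_abs_mul (by positivity) (by positivity) (by linarith) (by linarith)
    · rw [mul_right_comm, mul_comm _ T]
      refine le_trans ?_ (mul_le_mul_of_nonneg_left h2 hT0.le)
      exact rpow_le_two_rpow_abs_mul (by positivity) (by positivity) (by linarith) (by linarith)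

/-- Increments of the odd power at a contracted base point `v B`, damped by the factor `v`, are
controlled by increments of the same length at `B`. For `p < 2` the damping is essential. -/
lemma exists_oddPow_contract_bound (hp : 1 < p) : ∃ K : ℝ, 0 < K ∧ ∀ v B L : ℝ,
    0 ≤ v → v ≤ 1 → 0 ≤ L →
    v * (oddPow p (v * B + L) - oddPow p (v * B)) ≤ K * (oddPow p B - oddPow p (B - L)) := by
  obtain ⟨K, hK, hU⟩ := exists_oddPow_increment_bounds hp
  have unit : ∀ v B : ℝ, 0 ≤ v → v ≤ 1 →
      v * (oddPow p (v * B + 1) - oddPow p (v * B)) ≤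
        K * 2 ^ |p - 2| * K * (oddPow p B - oddPow p (B - 1)) := fun v B hv hv1 => by
    have hdamp : v * (1 + |v * B|) ^ (p - 2) ≤ (1 + |B|) ^ (p - 2) := by
      rw [abs_mul, abs_of_nonneg hv]
      rcases le_or_gt 2 p with h2 | h2
      · calc v * (1 + v * |B|) ^ (p - 2) ≤ 1 * (1 + |B|) ^ (p - 2) := by
              refine mul_le_mul hv1 (Real.rpow_le_rpow (by positivity) ?_ (by linarith))
                (by positivity) zero_le_one
              nlinarith [abs_nonneg B]
          _ = _ := one_mul _
      · rcases hv.eq_or_lt with rfl | hv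
        · rw [zero_mul]; positivity
        have h1 : (1 + v * |B|) ^ (p - 2) ≤ (v * (1 + |B|)) ^ (p - 2) :=
          Real.rpow_le_rpow_of_nonpos (by positivity) (by nlinarith [abs_nonneg B]) (by linarith)
        calc v * (1 + v * |B|) ^ (p - 2) ≤ v * (v * (1 + |B|)) ^ (p - 2) := by gcongr
          _ = v ^ (p - 1) * (1 + |B|) ^ (p - 2) := by
              rw [Real.mul_rpow hv.le (by positivity), ← mul_assoc, ← Real.rpow_one_add' hv.le
                (by linarith)]
              congr 2; ring
          _ ≤ 1 * (1 + |B|) ^ (p - 2) := by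
              gcongr
              exact Real.rpow_le_one hv.le hv1 (by linarith)
          _ = _ := one_mul _
    have hB := (hU (B - 1)).2
    rw [sub_add_cancel] at hB
    have hshift : (1 + |B|) ^ (p - 2) ≤ 2 ^ |p - 2| * (1 + |B - 1|) ^ (p - 2) := by
      have h1 := abs_sub_abs_le_abs_sub B (B - 1)
      have h2 := abs_sub_abs_le_abs_sub (B - 1) B
      rw [show B - (B - 1) = 1 by ring, abs_one] at h1
      rw [show B - 1 - B = -1 by ring, abs_neg, abs_one] at h2
      exact rpow_le_two_rpow_abs_mul (by positivity) (by positivity)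
        (by linarith [abs_nonneg (B - 1)]) (by linarith [abs_nonneg B])
    calc v * (oddPow p (v * B + 1) - oddPow p (v * B))
        ≤ v * (K * (1 + |v * B|) ^ (p - 2)) := by gcongr; exact (hU (v * B)).1
      _ = K * (v * (1 + |v * B|) ^ (p - 2)) := by ring
      _ ≤ K * (2 ^ |p - 2| * (K * (oddPow p B - oddPow p (B - 1)))) := by
          exact mul_le_mul_of_nonneg_left
            (hdamp.trans (hshift.trans (mul_le_mul_of_nonneg_left hB (by positivity)))) hK.le
      _ = _ := by ring
  refine ⟨K * 2 ^ |p - 2| * K, by positivity, fun v B L hv hv1 hL => ?_⟩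
  rcases hL.eq_or_lt with rfl | hL
  · simp
  obtain ⟨x, rfl⟩ : ∃ x, B = L * x := ⟨B / L, by field_simp⟩
  have h := mul_le_mul_of_nonneg_left (unit v x hv hv1) (Real.rpow_nonneg hL.le (p - 1))
  rw [show v * (L * x) + L = L * (v * x + 1) by ring, show v * (L * x) = L * (v * x) by ring,
    show L * x - L = L * (x - 1) by ring, oddPow_mul hp hL.le, oddPow_mul hp hL.le,
    oddPow_mul hp hL.le, oddPow_mul hp hL.le]
  linarith

end OddPow

/-! ### The Picone gap on an edge -/

/-- The gap in the discrete Picone inequality on an edge with the values `a`, `b` of the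
supersolution `u` and the values `s`, `t` of the quotient `φ / u`. -/
noncomputable def piconeGap (p a b s t : ℝ) : ℝ :=
  |a * s - b * t| ^ p - oddPow p (a - b) * (a * s ^ p - b * t ^ p)

section PiconeGap

variable {p : ℝ}

lemma piconeGap_swap (a b s t : ℝ) : piconeGap p a b s t = piconeGap p b a t s := by
  rw [piconeGap, piconeGap, abs_sub_comm, show a - b = -(b - a) by ring, oddPow_neg]
  ring

lemma piconeGap_mul (a b : ℝ) {s x y : ℝ} (hs : 0 ≤ s) (hx : 0 ≤ x) (hy : 0 ≤ y) :
    piconeGap p a b (s * x) (s * y) = s ^ p * piconeGap p a b x y := by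
  rw [piconeGap, piconeGap, Real.mul_rpow hs hx, Real.mul_rpow hs hy,
    show a * (s * x) - b * (s * y) = s * (a * x - b * y) by ring, abs_mul, abs_of_nonneg hs,
    Real.mul_rpow hs (abs_nonneg _)]
  ring

lemma piconeGap_one_one (hp : 1 < p) (a b : ℝ) : piconeGap p a b 1 1 = 0 := by
  rw [piconeGap, Real.one_rpow, mul_one, mul_one, oddPow_mul_self hp, sub_self]

lemma hasDerivAt_piconeGap (hp : 1 < p) (a b : ℝ) {z : ℝ} (hz : 0 ≤ z) :
    HasDerivAt (fun w => piconeGap p a b 1 w)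
      (-(p * b * (oddPow p (a - b * z) - oddPow p (z * (a - b))))) z := by
  have h1 : HasDerivAt (fun w : ℝ => a * 1 - b * w) (-b) z := by
    simpa using ((hasDerivAt_id z).const_mul b).const_sub (a * 1)
  have h2 := (hasDerivAt_abs_rpow (a * 1 - b * z) hp).comp z h1
  have h3 := (((Real.hasDerivAt_rpow_const (x := z) (p := p) (Or.inr hp.le)).const_mul
    b).const_sub (a * 1 ^ p)).const_mul (oddPow p (a - b))
  refine (h2.sub h3).congr_deriv ?_
  rw [oddPow_mul hp hz]
  simp only [oddPow, mul_one]
  ring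

lemma antitoneOn_piconeGap (hp : 1 < p) {a b : ℝ} (ha : 0 ≤ a) (hb : 0 ≤ b) :
    AntitoneOn (fun w => piconeGap p a b 1 w) (Set.Icc 0 1) := by
  refine antitoneOn_of_deriv_nonpos (convex_Icc 0 1)
    (fun z hz => (hasDerivAt_piconeGap hp a b hz.1).continuousAt.continuousWithinAt)
    (fun z hz => ?_) (fun z hz => ?_)
  · rw [interior_Icc] at hz
    exact (hasDerivAt_piconeGap hp a b hz.1.le).differentiableAt.differentiableWithinAt
  · rw [interior_Icc] at hz
    rw [(hasDerivAt_piconeGap hp a b hz.1.le).deriv]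
    have : oddPow p (z * (a - b)) ≤ oddPow p (a - b * z) :=
      (strictMono_oddPow hp).monotone (by nlinarith [hz.2])
    have : 0 ≤ p * b * (oddPow p (a - b * z) - oddPow p (z * (a - b))) :=
      mul_nonneg (by positivity) (by linarith)
    linarith

/-- Squaring the ratio of the values increases the Picone gap at most by a constant factor that
is independent of the supersolution. -/
lemma exists_piconeGap_sq_bound (hp : 1 < p) : ∃ C : ℝ, 1 ≤ C ∧ ∀ a b z : ℝ, 0 ≤ a → 0 ≤ b →
    0 ≤ z → z ≤ 1 → piconeGap p a b 1 (z ^ 2) ≤ C * piconeGap p a b 1 z := by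
  obtain ⟨K, hK, hKb⟩ := exists_oddPow_contract_bound hp
  refine ⟨2 + 2 * K, by linarith, fun a b z ha hb hz hz1 => ?_⟩
  have hder : ∀ v : ℝ, 0 ≤ v → HasDerivAt
      (fun w => (2 + 2 * K) * piconeGap p a b 1 w - piconeGap p a b 1 (w ^ 2))
      ((2 + 2 * K) * -(p * b * (oddPow p (a - b * v) - oddPow p (v * (a - b)))) -
        -(p * b * (oddPow p (a - b * v ^ 2) - oddPow p (v ^ 2 * (a - b)))) * (2 * v)) v :=
    fun v hv => by
      have h1 := (hasDerivAt_piconeGap hp a b hv).const_mul (2 + 2 * K)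
      have h2 : HasDerivAt (fun w : ℝ => w ^ 2) (2 * v) v := by simpa using hasDerivAt_pow 2 v
      exact h1.sub (HasDerivAt.comp (h₂ := fun w => piconeGap p a b 1 w) v
        (hasDerivAt_piconeGap hp a b (sq_nonneg v)) h2)
  have anti : AntitoneOn
      (fun w => (2 + 2 * K) * piconeGap p a b 1 w - piconeGap p a b 1 (w ^ 2)) (Set.Icc 0 1) := by
    refine antitoneOn_of_deriv_nonpos (convex_Icc 0 1)
      (fun v hv => (hder v hv.1).continuousAt.continuousWithinAt)
      (fun v hv => ?_) (fun v hv => ?_)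
    · rw [interior_Icc] at hv
      exact (hder v hv.1.le).differentiableAt.differentiableWithinAt
    · rw [interior_Icc] at hv
      obtain ⟨hv0, hv1⟩ := hv
      rw [(hder v hv0.le).deriv]
      -- with `B = a - b v` and `L = a (1 - v)`, the increment of `h` over
      -- `[v (B - L), v B + L]` is split at `v B`
      have hc := hKb v (a - b * v) (a * (1 - v)) hv0.le hv1.le
        (mul_nonneg ha (by linarith))
      rw [show v * (a - b * v) + a * (1 - v) = a - b * v ^ 2 by ring,
        show a - b * v - a * (1 - v) = v * (a - b) by ring, oddPow_mul hp hv0.le (a - b * v)] at hc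
      rw [show v ^ 2 * (a - b) = v * (v * (a - b)) by ring,
        oddPow_mul hp hv0.le (v * (a - b))]
      have hinc : 0 ≤ oddPow p (a - b * v) - oddPow p (v * (a - b)) :=
        sub_nonneg.2 ((strictMono_oddPow hp).monotone (by nlinarith))
      have hvp : v * v ^ (p - 1) ≤ 1 :=
        mul_le_one₀ hv1.le (by positivity) (Real.rpow_le_one hv0.le hv1.le (by linarith))
      have hmain : v * (oddPow p (a - b * v ^ 2) - v ^ (p - 1) * oddPow p (v * (a - b))) ≤
          (1 + K) * (oddPow p (a - b * v) - oddPow p (v * (a - b))) := by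
        have := mul_le_mul_of_nonneg_right hvp hinc
        linarith
      have := mul_le_mul_of_nonneg_left hmain (by positivity : 0 ≤ 2 * (p * b))
      linarith
  have h := anti ⟨hz, hz1⟩ (Set.right_mem_Icc.2 zero_le_one) hz1
  simp only [one_pow, piconeGap_one_one hp] at h
  linarith

lemma piconeGap_nonneg (hp : 1 < p) {a b s t : ℝ} (ha : 0 ≤ a) (hb : 0 ≤ b) (hs : 0 ≤ s)
    (ht : 0 ≤ t) : 0 ≤ piconeGap p a b s t := by
  wlog hts : t ≤ s generalizing a b s t
  · rw [piconeGap_swap]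
    exact this hb ha ht hs (le_of_not_ge hts)
  rcases hs.eq_or_lt with rfl | hs
  · obtain rfl : t = 0 := le_antisymm hts ht
    simp [piconeGap, Real.zero_rpow (by linarith : p ≠ 0)]
  have hz : t / s ∈ Set.Icc (0 : ℝ) 1 := ⟨by positivity, (div_le_one hs).2 hts⟩
  have h := antitoneOn_piconeGap hp ha hb hz (Set.right_mem_Icc.2 zero_le_one) hz.2
  simp only [piconeGap_one_one hp] at h
  have e := piconeGap_mul (p := p) a b hs.le zero_le_one hz.1
  rw [mul_one, mul_div_cancel₀ _ hs.ne'] at e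
  rw [e]
  positivity

end PiconeGap

/-! ### Quadratic truncation at dyadic levels -/

/-- Quadratic truncation of `s ≥ 0` at the level `l > 0`: it equals `s ^ 2 / l` up to the level
and `l` above it. -/
noncomputable def sqTrunc (l s : ℝ) : ℝ := l * min (s / l) 1 ^ 2

/-- The increments over one dyadic scale of the bounded function `r / (1 + r)`, which telescope.
They dominate `min r (1 / r)`. -/
noncomputable def scaleWeight (r : ℝ) : ℝ := 2 * r / (1 + 2 * r) - r / (1 + r)

section Truncation

variable {p : ℝ}

lemma sum_scaleWeight_le {r : ℝ} (hr : 0 ≤ r) (N : ℕ) :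
    ∑ j ∈ Finset.range N, scaleWeight (2 ^ j * r) ≤ 1 := by
  have : ∀ j : ℕ, scaleWeight (2 ^ j * r) =
      2 ^ (j + 1) * r / (1 + 2 ^ (j + 1) * r) - 2 ^ j * r / (1 + 2 ^ j * r) := fun j => by
    rw [scaleWeight, pow_succ']; simp only [mul_assoc]
  simp only [this]
  rw [Finset.sum_range_sub (fun j : ℕ => (2 ^ j * r / (1 + 2 ^ j * r) : ℝ))]
  have h1 : 2 ^ N * r / (1 + 2 ^ N * r) ≤ 1 := by
    rw [div_le_one (by positivity)]; linarith
  have h2 : 0 ≤ 2 ^ 0 * r / (1 + 2 ^ 0 * r) := by positivity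
  linarith

lemma sqTrunc_nonneg {l : ℝ} (hl : 0 < l) (s : ℝ) : 0 ≤ sqTrunc l s := by
  unfold sqTrunc; positivity

lemma sqTrunc_div_rpow_le (hp : 1 < p) {l s : ℝ} (hl : 0 < l) (hs : 0 < s) :
    (sqTrunc l s / s) ^ p ≤ 6 * scaleWeight (s / l) := by
  have hr : 0 < s / l := by positivity
  have e : sqTrunc l s / s = min (s / l) 1 ^ 2 / (s / l) := by
    rw [sqTrunc]; field_simp
  have hle : sqTrunc l s / s ≤ 1 := by
    rw [e, div_le_one hr]
    rcases le_total (s / l) 1 with h | h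
    · rw [min_eq_left h]; nlinarith
    · rw [min_eq_right h]; linarith
  refine (Real.rpow_le_rpow_of_exponent_ge' (div_nonneg (sqTrunc_nonneg hl s) hs.le) hle zero_le_one
    hp.le).trans ?_
  have : scaleWeight (s / l) = (s / l) / ((1 + 2 * (s / l)) * (1 + s / l)) := by
    rw [scaleWeight]; generalize s / l = r at hr; field_simp; ring
  rw [Real.rpow_one, e, this]
  generalize s / l = r at hr
  rw [← mul_div_assoc, div_le_div_iff₀ hr (by positivity)]
  rcases le_total r 1 with h | h
  · rw [min_eq_left h]
    have : (1 + 2 * r) * (1 + r) ≤ 6 := by nlinarith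
    nlinarith [sq_nonneg r]
  · rw [min_eq_right h]; nlinarith

/-- `C` is the constant of `exists_piconeGap_sq_bound`. -/
lemma piconeGap_sqTrunc_le (hp : 1 < p) {C : ℝ} (hC0 : 1 ≤ C)
    (hC : ∀ a b z : ℝ, 0 ≤ a → 0 ≤ b → 0 ≤ z → z ≤ 1 →
      piconeGap p a b 1 (z ^ 2) ≤ C * piconeGap p a b 1 z)
    {a b s t l : ℝ} (ha : 0 ≤ a) (hb : 0 ≤ b) (hs : 0 ≤ s) (ht : 0 ≤ t) (hl : 0 < l) :
    piconeGap p a b (sqTrunc l s) (sqTrunc l t) ≤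
      6 * C * scaleWeight (max s t / l) * piconeGap p a b s t := by
  wlog hts : t ≤ s generalizing a b s t
  · rw [piconeGap_swap, piconeGap_swap a b s t, max_comm]
    exact this hb ha ht hs (le_of_not_ge hts)
  rw [max_eq_left hts]
  rcases hs.eq_or_lt with rfl | hs
  · obtain rfl : t = 0 := le_antisymm hts ht
    simp [piconeGap, sqTrunc, Real.zero_rpow (by linarith : p ≠ 0)]
  have hmin : 0 < min (s / l) 1 := by positivity
  have hmint : 0 ≤ min (t / l) 1 := by positivity
  set w := min (t / l) 1 / min (s / l) 1 with hw
  have hw0 : 0 ≤ w := by positivity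
  have hw1 : w ≤ 1 := by
    rw [hw, div_le_one hmin]
    gcongr
  have hwz : t / s ≤ w := by
    rw [hw, div_le_div_iff₀ hs hmin]
    rcases le_total (t / l) 1 with h | h
    · rw [min_eq_left h]
      calc t * min (s / l) 1 ≤ t * (s / l) := by gcongr; exact min_le_left _ _
        _ = t / l * s := by ring
    · rw [min_eq_right h, one_mul]
      calc t * min (s / l) 1 ≤ t * 1 := by gcongr; exact min_le_right _ _
        _ ≤ s := by linarith
  have hT : sqTrunc l t = sqTrunc l s * w ^ 2 := by
    rw [sqTrunc, sqTrunc, hw]; field_simp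
  have hs0 := sqTrunc_nonneg hl s
  have hz0 : 0 ≤ t / s := by positivity
  have hgap : piconeGap p a b s t = s ^ p * piconeGap p a b 1 (t / s) := by
    have e := piconeGap_mul (p := p) a b hs.le zero_le_one hz0
    rwa [mul_one, mul_div_cancel₀ _ hs.ne'] at e
  have hgapT : piconeGap p a b (sqTrunc l s) (sqTrunc l t) =
      sqTrunc l s ^ p * piconeGap p a b 1 (w ^ 2) := by
    have e := piconeGap_mul (p := p) a b hs0 zero_le_one (sq_nonneg w)
    rwa [mul_one, ← hT] at e
  have hmono : piconeGap p a b 1 w ≤ piconeGap p a b 1 (t / s) :=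
    antitoneOn_piconeGap hp ha hb ⟨hz0, hwz.trans hw1⟩ ⟨hw0, hw1⟩ hwz
  have hpow : sqTrunc l s ^ p = (sqTrunc l s / s) ^ p * s ^ p := by
    rw [← Real.mul_rpow (by positivity) hs.le, div_mul_cancel₀ _ hs.ne']
  have hg0 := piconeGap_nonneg hp ha hb hs.le ht
  calc piconeGap p a b (sqTrunc l s) (sqTrunc l t)
      ≤ sqTrunc l s ^ p * (C * piconeGap p a b 1 (t / s)) := by
        rw [hgapT]
        gcongr
        exact (hC a b w ha hb hw0 hw1).trans (by gcongr)
    _ = (sqTrunc l s / s) ^ p * (C * piconeGap p a b s t) := by rw [hgap, hpow]; ring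
    _ ≤ 6 * scaleWeight (s / l) * (C * piconeGap p a b s t) :=
        mul_le_mul_of_nonneg_right (sqTrunc_div_rpow_le hp hl hs) (by positivity)
    _ = _ := by ring

lemma sqTrunc_rpow_le (hp : 1 < p) {l s : ℝ} (hl : 0 < l) (hs : 0 ≤ s) :
    sqTrunc l s ^ p ≤ 6 * scaleWeight (s / l) * s ^ p := by
  rcases hs.eq_or_lt with rfl | hs
  · simp [sqTrunc, Real.zero_rpow (by linarith : p ≠ 0)]
  calc sqTrunc l s ^ p = (sqTrunc l s / s) ^ p * s ^ p := by
        rw [← Real.mul_rpow (div_nonneg (sqTrunc_nonneg hl s) hs.le) hs.le,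
          div_mul_cancel₀ _ hs.ne']
    _ ≤ _ := mul_le_mul_of_nonneg_right (sqTrunc_div_rpow_le hp hl hs) (by positivity)

end Truncation

/-! ### The ground state representation -/

section Energy

variable {X : Type*} {p : ℝ} {G : ConnectedGraph X} {m c u : X → ℝ}

/-- The incidence sums over a finite vertex set converge, without local finiteness. -/
lemma summable_prod_of_support {k : X → X → ℝ} {f : X → ℝ} (hf : f.support.Finite)
    (hk : ∀ x, Summable (k x)) : Summable fun z : X × X => f z.1 * k z.1 z.2 := by
  classical
  have hsingle : ∀ x : X, Summable fun z : X × X => if z.1 = x then f x * k x z.2 else 0 := by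
    intro x
    have hinj : Function.Injective (fun y : X => (x, y)) := fun y y' h => (Prod.ext_iff.1 h).2
    rw [← hinj.summable_iff]
    · simpa [Function.comp_def] using (hk x).mul_left (f x)
    · rintro ⟨a, y⟩ hz
      have : a ≠ x := fun h => hz ⟨y, by simp [h]⟩
      simp [this]
  refine (summable_sum (s := hf.toFinset) fun x _ => hsingle x).congr fun z => ?_
  by_cases hz : z.1 ∈ hf.toFinset
  · rw [Finset.sum_ite_eq, if_pos hz]
  · rw [Finset.sum_ite_eq, if_neg hz]
    have : f z.1 = 0 := by simpa using hz
    simp [this]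

lemma tsum_prod_of_support {k : X → X → ℝ} {f : X → ℝ} (hf : f.support.Finite)
    (hk : ∀ x, Summable (k x)) :
    ∑' z : X × X, f z.1 * k z.1 z.2 = ∑' x, f x * ∑' y, k x y := by
  rw [(summable_prod_of_support hf hk).tsum_prod' fun x => (hk x).mul_left (f x)]
  simp only [tsum_mul_left]

lemma summable_of_support {f w : X → ℝ} (hf : f.support.Finite) (h : ∀ x, f x = 0 → w x = 0) :
    Summable w :=
  summable_of_hasFiniteSupport (hf.subset fun x hx hfx => hx (h x hfx))

lemma summable_energy (hp : 1 < p) {φ : X → ℝ} (hφ : φ.support.Finite) :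
    Summable fun z : X × X => G.b z.1 z.2 * |φ z.1 - φ z.2| ^ p := by
  have hsupp : (fun x => (2 * |φ x|) ^ p).support.Finite := hφ.subset fun x hx hφx => hx (by
    simp [hφx, Real.zero_rpow (by linarith : p ≠ 0)])
  have h1 := summable_prod_of_support hsupp G.summable
  have h2 := (Equiv.prodComm X X).summable_iff.2 h1
  refine (h1.add h2).of_nonneg_of_le
    (fun z => mul_nonneg (G.nonneg _ _) (by positivity)) fun z => ?_
  have hle : |φ z.1 - φ z.2| ^ p ≤ (2 * |φ z.1|) ^ p + (2 * |φ z.2|) ^ p := by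
    have htri := abs_sub (φ z.1) (φ z.2)
    have n1 : 0 ≤ (2 * |φ z.1|) ^ p := by positivity
    have n2 : 0 ≤ (2 * |φ z.2|) ^ p := by positivity
    rcases le_total |φ z.1| |φ z.2| with h | h
    · have : |φ z.1 - φ z.2| ^ p ≤ (2 * |φ z.2|) ^ p :=
        Real.rpow_le_rpow (abs_nonneg _) (by linarith) (by linarith)
      linarith
    · have : |φ z.1 - φ z.2| ^ p ≤ (2 * |φ z.1|) ^ p :=
        Real.rpow_le_rpow (abs_nonneg _) (by linarith) (by linarith)
      linarith
  have := mul_le_mul_of_nonneg_left hle (G.nonneg z.1 z.2)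
  simp only [Function.comp, Equiv.prodComm_apply, Prod.fst_swap, Prod.snd_swap,
    G.symm z.2 z.1]
  linarith

lemma energy_smul {l : ℝ} (hl : 0 ≤ l) (φ : X → ℝ) :
    energy p G c (fun x => l * φ x) = l ^ p * energy p G c φ := by
  have h1 : ∀ z : X × X, G.b z.1 z.2 * |l * φ z.1 - l * φ z.2| ^ p =
      l ^ p * (G.b z.1 z.2 * |φ z.1 - φ z.2| ^ p) := fun z => by
    rw [← mul_sub, abs_mul, abs_of_nonneg hl, Real.mul_rpow hl (abs_nonneg _)]; ring
  have h2 : ∀ x, c x * |l * φ x| ^ p = l ^ p * (c x * |φ x| ^ p) := fun x => by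
    rw [abs_mul, abs_of_nonneg hl, Real.mul_rpow hl (abs_nonneg _)]; ring
  simp only [energy, h1, h2, tsum_mul_left]
  ring

lemma energy_abs_le (hp : 1 < p) {φ : X → ℝ} (hφ : φ.support.Finite) :
    energy p G c (fun x => |φ x|) ≤ energy p G c φ := by
  have habs : (fun x => |φ x|).support.Finite := hφ.subset fun x hx hφx => hx (by simp [hφx])
  simp only [energy, abs_abs]
  have : ∑' z : X × X, G.b z.1 z.2 * |(|φ z.1| - |φ z.2|)| ^ p ≤
      ∑' z : X × X, G.b z.1 z.2 * |φ z.1 - φ z.2| ^ p :=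
    (summable_energy (G := G) hp habs).tsum_le_tsum (fun z => mul_le_mul_of_nonneg_left
      (Real.rpow_le_rpow (abs_nonneg _) (abs_abs_sub_abs_le _ _) (by linarith)) (G.nonneg _ _))
      (summable_energy hp hφ)
  linarith

/-- The Schrödinger operator applied to `u`, without the normalization by the measure, times `u`:
the potential in the ground state representation. -/
noncomputable def groundPotential (p : ℝ) (G : ConnectedGraph X) (c u : X → ℝ) (x : X) : ℝ :=
  (∑' y, G.b x y * oddPow p (u x - u y) + c x * oddPow p (u x)) * u x

lemma groundPotential_nonneg (hm : ∀ x, 0 < m x) (hu : ∀ x, 0 < u x)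
    (hsup : IsSupersolution p G m c u) (x : X) : 0 ≤ groundPotential p G c u x := by
  refine mul_nonneg ?_ (hu x).le
  have h : m x * pSchrodinger p G m c u x =
      ∑' y, G.b x y * oddPow p (u x - u y) + c x * oddPow p (u x) := by
    have := (hm x).ne'
    simp only [pSchrodinger, pLaplacian, oddPow]
    field_simp
  rw [← h]
  exact mul_nonneg (hm x).le (hsup.2 x)

lemma summable_oddPow (hp : 1 < p) (hF : MemF p G u) (x : X) :
    Summable fun y => G.b x y * oddPow p (u x - u y) := by
  refine Summable.of_norm ((hF x).congr fun y => ?_)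
  rw [Real.norm_eq_abs, abs_mul, abs_of_nonneg (G.nonneg x y), abs_oddPow hp]

lemma hasSum_green (hp : 1 < p) (hF : MemF p G u) {w : X → ℝ} (hw : w.support.Finite) :
    HasSum (fun z : X × X => G.b z.1 z.2 * (oddPow p (u z.1 - u z.2) * (w z.1 - w z.2)))
      (2 * ∑' x, w x * ∑' y, G.b x y * oddPow p (u x - u y)) := by
  have h1 := (summable_prod_of_support hw (summable_oddPow hp hF)).hasSum
  rw [tsum_prod_of_support hw (summable_oddPow hp hF)] at h1
  have h2 := (Equiv.prodComm X X).hasSum_iff.2 h1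
  rw [two_mul]
  refine (h1.add h2).congr_fun ?_
  intro z
  simp only [Function.comp, Equiv.prodComm_apply, Prod.fst_swap, Prod.snd_swap]
  rw [G.symm z.2 z.1, show u z.2 - u z.1 = -(u z.1 - u z.2) by ring, oddPow_neg]
  ring

lemma summable_piconeGap (hp : 1 < p) (hF : MemF p G u) {ψ : X → ℝ} (hψ : ψ.support.Finite) :
    Summable fun z : X × X => G.b z.1 z.2 * piconeGap p (u z.1) (u z.2) (ψ z.1) (ψ z.2) := by
  have hφ : (fun x => u x * ψ x).support.Finite := hψ.subset fun x hx h => hx (by simp [h])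
  have hw : (fun x => u x * ψ x ^ p).support.Finite := hψ.subset fun x hx h => hx (by
    simp [h, Real.zero_rpow (by linarith : p ≠ 0)])
  refine ((summable_energy (G := G) hp hφ).sub (hasSum_green hp hF hw).summable).congr fun z => ?_
  simp only [piconeGap]
  ring

/-- Ground state representation of the energy. -/
lemma energy_mul_eq (hp : 1 < p) (hF : MemF p G u) {ψ : X → ℝ}
    (hψ : ψ.support.Finite) (hψ0 : ∀ x, 0 ≤ ψ x) :
    energy p G c (fun x => u x * ψ x) =
      (1 / 2) * ∑' z : X × X, G.b z.1 z.2 * piconeGap p (u z.1) (u z.2) (ψ z.1) (ψ z.2) +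
        ∑' x, groundPotential p G c u x * ψ x ^ p := by
  have h0 : (0 : ℝ) ^ p = 0 := Real.zero_rpow (by linarith)
  have hφ : (fun x => u x * ψ x).support.Finite := hψ.subset fun x hx h => hx (by simp [h])
  have hw : (fun x => u x * ψ x ^ p).support.Finite := hψ.subset fun x hx h => hx (by simp [h, h0])
  have hg := hasSum_green hp hF hw
  have hgap : ∑' z : X × X, G.b z.1 z.2 * piconeGap p (u z.1) (u z.2) (ψ z.1) (ψ z.2) =
      ∑' z : X × X, G.b z.1 z.2 * |u z.1 * ψ z.1 - u z.2 * ψ z.2| ^ p -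
        2 * ∑' x, u x * ψ x ^ p * ∑' y, G.b x y * oddPow p (u x - u y) := by
    rw [← hg.tsum_eq, ← (summable_energy (G := G) hp hφ).tsum_sub hg.summable]
    refine tsum_congr fun z => ?_
    simp only [piconeGap]
    ring
  have hpot : ∑' x, groundPotential p G c u x * ψ x ^ p =
      ∑' x, u x * ψ x ^ p * ∑' y, G.b x y * oddPow p (u x - u y) +
        ∑' x, c x * |u x * ψ x| ^ p := by
    rw [← (summable_of_support hψ fun x hx => by simp [hx, h0]).tsum_add
      (summable_of_support hψ fun x hx => by simp [hx, h0])]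
    refine tsum_congr fun x => ?_
    have e : |u x * ψ x| ^ p = oddPow p (u x) * u x * ψ x ^ p := by
      rw [oddPow_mul_self hp, abs_mul, Real.mul_rpow (abs_nonneg _) (abs_nonneg _),
        abs_of_nonneg (hψ0 x)]
    rw [e, groundPotential]
    ring
  rw [energy, hgap, hpot]
  ring

/-- The constant `C` is the one of `exists_piconeGap_sq_bound`. The energies of the truncations
at the dyadic levels below `l` add up to at most a multiple of the energy. -/
lemma sum_energy_sqTrunc_le (hp : 1 < p) {C : ℝ} (hC0 : 1 ≤ C)
    (hC : ∀ a b z : ℝ, 0 ≤ a → 0 ≤ b → 0 ≤ z → z ≤ 1 →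
      piconeGap p a b 1 (z ^ 2) ≤ C * piconeGap p a b 1 z)
    (hm : ∀ x, 0 < m x) (hu : ∀ x, 0 < u x) (hsup : IsSupersolution p G m c u) {ψ : X → ℝ}
    (hψ : ψ.support.Finite) (hψ0 : ∀ x, 0 ≤ ψ x) {l : ℝ} (hl : 0 < l) (N : ℕ) :
    ∑ j ∈ Finset.range N, energy p G c (fun x => u x * sqTrunc (l / 2 ^ j) (ψ x)) ≤
      6 * C * energy p G c (fun x => u x * ψ x) := by
  have h0 : (0 : ℝ) ^ p = 0 := Real.zero_rpow (by linarith)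
  have hF := hsup.1
  have hlj : ∀ j : ℕ, 0 < l / 2 ^ j := fun j => by positivity
  have hT : ∀ j : ℕ, (fun x => sqTrunc (l / 2 ^ j) (ψ x)).support.Finite := fun j =>
    hψ.subset fun x hx h => hx (by simp [sqTrunc, h])
  have hsw : ∀ s : ℝ, 0 ≤ s → ∑ j ∈ Finset.range N, scaleWeight (s / (l / 2 ^ j)) ≤ 1 :=
    fun s hs => by
      have := sum_scaleWeight_le (r := s / l) (by positivity) N
      refine le_of_eq_of_le (Finset.sum_congr rfl fun j _ => ?_) this
      congr 1
      field_simp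
  have hedge : ∑ j ∈ Finset.range N, ∑' z : X × X, G.b z.1 z.2 * piconeGap p (u z.1) (u z.2)
        (sqTrunc (l / 2 ^ j) (ψ z.1)) (sqTrunc (l / 2 ^ j) (ψ z.2)) ≤
      6 * C * ∑' z : X × X, G.b z.1 z.2 * piconeGap p (u z.1) (u z.2) (ψ z.1) (ψ z.2) := by
    rw [← Summable.tsum_finsetSum fun j _ => summable_piconeGap hp hF (hT j), ← tsum_mul_left]
    refine (summable_sum fun j _ => summable_piconeGap hp hF (hT j)).tsum_le_tsum (fun z => ?_)
      ((summable_piconeGap hp hF hψ).mul_left _)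
    have hg := piconeGap_nonneg hp (hu z.1).le (hu z.2).le (hψ0 z.1) (hψ0 z.2)
    have hb := G.nonneg z.1 z.2
    have hmax : 0 ≤ max (ψ z.1) (ψ z.2) := le_max_of_le_left (hψ0 _)
    calc ∑ j ∈ Finset.range N, G.b z.1 z.2 * piconeGap p (u z.1) (u z.2)
          (sqTrunc (l / 2 ^ j) (ψ z.1)) (sqTrunc (l / 2 ^ j) (ψ z.2))
        ≤ ∑ j ∈ Finset.range N, G.b z.1 z.2 * (6 * C * scaleWeight
            (max (ψ z.1) (ψ z.2) / (l / 2 ^ j)) * piconeGap p (u z.1) (u z.2) (ψ z.1) (ψ z.2)) :=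
          Finset.sum_le_sum fun j _ => mul_le_mul_of_nonneg_left (piconeGap_sqTrunc_le hp hC0 hC
            (hu _).le (hu _).le (hψ0 _) (hψ0 _) (hlj j)) hb
      _ = (6 * C * (G.b z.1 z.2 * piconeGap p (u z.1) (u z.2) (ψ z.1) (ψ z.2))) *
            ∑ j ∈ Finset.range N, scaleWeight (max (ψ z.1) (ψ z.2) / (l / 2 ^ j)) := by
          rw [Finset.mul_sum]
          exact Finset.sum_congr rfl fun j _ => by ring
      _ ≤ _ := mul_le_of_le_one_right (by positivity) (hsw _ hmax)
  have hvertex : ∑ j ∈ Finset.range N,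
        ∑' x, groundPotential p G c u x * sqTrunc (l / 2 ^ j) (ψ x) ^ p ≤
      6 * C * ∑' x, groundPotential p G c u x * ψ x ^ p := by
    have hs : ∀ j : ℕ, Summable fun x => groundPotential p G c u x *
        sqTrunc (l / 2 ^ j) (ψ x) ^ p := fun j =>
      summable_of_support hψ fun x hx => by simp [sqTrunc, hx, h0]
    have hs' : Summable fun x => groundPotential p G c u x * ψ x ^ p :=
      summable_of_support hψ fun x hx => by simp [hx, h0]
    rw [← Summable.tsum_finsetSum fun j _ => hs j, ← tsum_mul_left]
    refine (summable_sum fun j _ => hs j).tsum_le_tsum (fun x => ?_) (hs'.mul_left _)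
    have hW := groundPotential_nonneg hm hu hsup x
    have hx := hψ0 x
    calc ∑ j ∈ Finset.range N, groundPotential p G c u x * sqTrunc (l / 2 ^ j) (ψ x) ^ p
        ≤ ∑ j ∈ Finset.range N, groundPotential p G c u x *
            (6 * scaleWeight (ψ x / (l / 2 ^ j)) * ψ x ^ p) :=
          Finset.sum_le_sum fun j _ =>
            mul_le_mul_of_nonneg_left (sqTrunc_rpow_le hp (hlj j) hx) hW
      _ = (6 * (groundPotential p G c u x * ψ x ^ p)) *
            ∑ j ∈ Finset.range N, scaleWeight (ψ x / (l / 2 ^ j)) := by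
          rw [Finset.mul_sum]
          exact Finset.sum_congr rfl fun j _ => by ring
      _ ≤ 6 * (groundPotential p G c u x * ψ x ^ p) :=
          mul_le_of_le_one_right (by positivity) (hsw _ hx)
      _ ≤ C * (6 * (groundPotential p G c u x * ψ x ^ p)) :=
          le_mul_of_one_le_left (by positivity) hC0
      _ = _ := by ring
  rw [energy_mul_eq hp hF hψ hψ0, Finset.sum_congr rfl fun j _ =>
    energy_mul_eq hp hF (hT j) fun x => sqTrunc_nonneg (hlj j) _, Finset.sum_add_distrib,
    ← Finset.mul_sum]
  linarith

end Energy

/-! ### Capacity and the Hardy inequality -/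

section Capacity

variable {X : Type*} {p : ℝ} {G : ConnectedGraph X} {m c g u : X → ℝ}

lemma capacity_le (hQ : EnergyNonneg p G c) {K : Finset X} {φ : X → ℝ} (hφ : φ.support.Finite)
    (h : ∀ x, Set.indicator (K : Set X) u x ≤ φ x) : capacity p G c u K ≤ energy p G c φ :=
  csInf_le ⟨0, by rintro _ ⟨φ, ⟨hφ, -⟩, rfl⟩; exact hQ φ hφ⟩ ⟨φ, ⟨hφ, h⟩, rfl⟩

lemma le_capacity {K : Finset X} {a : ℝ}
    (h : ∀ φ : X → ℝ, φ.support.Finite → (∀ x, Set.indicator (K : Set X) u x ≤ φ x) →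
      a ≤ energy p G c φ) : a ≤ capacity p G c u K := by
  refine le_csInf (Set.Nonempty.image _ ⟨Set.indicator (K : Set X) u, ?_, fun x => le_rfl⟩) ?_
  · exact K.finite_toSet.subset Set.support_indicator_subset
  · rintro _ ⟨φ, ⟨hφ, hK⟩, rfl⟩
    exact h φ hφ hK

lemma capacityNorm_le_hardyNorm (hp : 1 < p) (hm : ∀ x, 0 < m x) (hu : ∀ x, 0 < u x) :
    capacityNorm p G m c u g ≤ hardyNorm p G m c g := by
  refine iSup_le fun K => ?_
  set S := ∑ x ∈ K, m x * u x ^ p * |g x| with hS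
  have hS0 : 0 ≤ S := Finset.sum_nonneg fun x _ => by
    have := hm x; have := hu x; positivity
  have hmul : hardyConst p G m c g * ENNReal.ofReal S ≤ ENNReal.ofReal (capacity p G c u K) := by
    rw [hardyConst, ENNReal.iSup_mul]
    refine iSup_le fun C => ?_
    rw [ENNReal.iSup_mul]
    refine iSup_le fun hC => ?_
    rw [← ENNReal.ofReal_coe_nnreal, ← ENNReal.ofReal_mul C.coe_nonneg]
    refine ENNReal.ofReal_le_ofReal (le_capacity fun φ hφ hK => le_trans ?_ (hC φ hφ))
    refine mul_le_mul_of_nonneg_left ?_ C.coe_nonneg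
    have hsum : Summable fun x => m x * |g x| * |φ x| ^ p :=
      summable_of_support hφ fun x hx => by simp [hx, Real.zero_rpow (by linarith : p ≠ 0)]
    refine le_trans (Finset.sum_le_sum fun x hx => ?_) (hsum.sum_le_tsum K fun x _ => by
      have := hm x; positivity)
    have hux : u x ≤ φ x := by
      have := hK x
      rwa [Set.indicator_of_mem (by simpa using hx)] at this
    have : u x ^ p ≤ |φ x| ^ p :=
      Real.rpow_le_rpow (hu x).le (hux.trans (le_abs_self _)) (by linarith)
    have := mul_le_mul_of_nonneg_left this (mul_nonneg (hm x).le (abs_nonneg (g x)))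
    linarith
  rw [hardyNorm]
  rcases eq_or_ne (hardyConst p G m c g) 0 with h | h
  · rw [h, ENNReal.inv_zero]
    exact le_top
  refine ENNReal.div_le_of_le_mul ?_
  rcases eq_or_ne (ENNReal.ofReal S) 0 with hS' | hS'
  · simp [hS']
  have htop : hardyConst p G m c g ≠ ⊤ := fun h => by
    rw [h, ENNReal.top_mul hS'] at hmul
    exact ENNReal.ofReal_ne_top (top_le_iff.1 hmul)
  calc ENNReal.ofReal S = (hardyConst p G m c g)⁻¹ * (hardyConst p G m c g * ENNReal.ofReal S) := by
        rw [← mul_assoc, ENNReal.inv_mul_cancel h htop, one_mul]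
    _ ≤ _ := by gcongr

/-- Strong capacitary inequality in integrated form, by the layer cake decomposition of `φ / u`
into dyadic level sets. `C` is the constant of `exists_piconeGap_sq_bound`, and `A` bounds the
measure of a finite set by its capacity. -/
lemma hardy_of_capacity (hp : 1 < p) {C : ℝ} (hC0 : 1 ≤ C)
    (hC : ∀ a b z : ℝ, 0 ≤ a → 0 ≤ b → 0 ≤ z → z ≤ 1 →
      piconeGap p a b 1 (z ^ 2) ≤ C * piconeGap p a b 1 z)
    (hm : ∀ x, 0 < m x) (hQ : EnergyNonneg p G c) (hu : ∀ x, 0 < u x)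
    (hsup : IsSupersolution p G m c u) {A : ℝ} (hA0 : 0 ≤ A)
    (hA : ∀ K : Finset X, ∑ x ∈ K, m x * u x ^ p * |g x| ≤ A * capacity p G c u K)
    {φ : X → ℝ} (hφ : φ.support.Finite) :
    ∑' x, m x * |g x| * |φ x| ^ p ≤ 2 ^ p * (6 * C) * A * energy p G c φ := by
  classical
  set ψ : X → ℝ := fun x => |φ x| / u x with hψdef
  have hψ0 : ∀ x, 0 ≤ ψ x := fun x => div_nonneg (abs_nonneg _) (hu x).le
  have hψ : ψ.support.Finite := hφ.subset fun x hx h => hx (by simp [hψdef, h])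
  have huψ : ∀ x, u x * ψ x = |φ x| := fun x => mul_div_cancel₀ _ (hu x).ne'
  set S := hψ.toFinset with hS
  have hSpos : ∀ x ∈ S, 0 < ψ x := fun x hx =>
    (hψ0 x).lt_of_ne' (by simpa [hS] using hx)
  -- a level above all values of `ψ`
  obtain ⟨l, hl, hψl⟩ : ∃ l : ℝ, 0 < l ∧ ∀ x ∈ S, ψ x ≤ l :=
    ⟨∑ x ∈ S, ψ x + 1, by have := Finset.sum_nonneg fun x (_ : x ∈ S) => hψ0 x; linarith,
      fun x hx => by have := Finset.single_le_sum (fun y _ => hψ0 y) hx; linarith⟩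
  have hlj : ∀ j : ℕ, 0 < l / 2 ^ j := fun j => by positivity
  have hscale : ∀ x, ∃ n : ℕ, x ∈ S → l / 2 ^ n ≤ ψ x ∧ ψ x ≤ 2 * (l / 2 ^ n) := fun x => by
    by_cases hx : x ∈ S
    · have hpos := hSpos x hx
      obtain ⟨n, h1, h2⟩ := exists_nat_pow_near ((one_le_div hpos).2 (hψl x hx))
        (one_lt_two (α := ℝ))
      rw [le_div_iff₀ hpos] at h1
      rw [div_lt_iff₀ hpos] at h2
      refine ⟨n + 1, fun _ => ⟨?_, ?_⟩⟩
      · rw [div_le_iff₀ (by positivity)]; linarith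
      · rw [pow_succ, ← mul_div_assoc, le_div_iff₀ (by positivity)]; linarith
    · exact ⟨0, fun h => absurd h hx⟩
  choose n hn using hscale
  set N := S.sup n + 1 with hN
  set K : ℕ → Finset X := fun j => S.filter fun x => l / 2 ^ j ≤ ψ x with hK
  have hT : ∀ j : ℕ, (fun x => u x * sqTrunc (l / 2 ^ j) (ψ x)).support.Finite := fun j =>
    hψ.subset fun x hx h => hx (by simp [sqTrunc, h])
  -- the truncation of `ψ` at a level, rescaled to `1`, is admissible for the level set
  have hcap : ∀ j : ℕ, (l / 2 ^ j) ^ p * capacity p G c u (K j) ≤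
      energy p G c (fun x => u x * sqTrunc (l / 2 ^ j) (ψ x)) := fun j => by
    have hsm := energy_smul (p := p) (G := G) (c := c) (hlj j).le
      (fun x => u x * min (ψ x / (l / 2 ^ j)) 1 ^ 2)
    have he : (fun x => u x * sqTrunc (l / 2 ^ j) (ψ x)) =
        fun x => l / 2 ^ j * (u x * min (ψ x / (l / 2 ^ j)) 1 ^ 2) := by
      funext x; rw [sqTrunc]; ring
    rw [he, hsm]
    refine mul_le_mul_of_nonneg_left (capacity_le hQ (hψ.subset fun x hx h => hx (by simp [h]))
      fun x => ?_) (Real.rpow_nonneg (hlj j).le _)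
    by_cases hx : x ∈ K j
    · have : 1 ≤ ψ x / (l / 2 ^ j) := (one_le_div (hlj j)).2 (Finset.mem_filter.1 hx).2
      rw [Set.indicator_of_mem (by simpa using hx), min_eq_right this]
      simp
    · rw [Set.indicator_of_notMem (by simpa using hx)]
      have := hu x
      positivity
  have hlayer : ∀ x ∈ S, ψ x ^ p ≤
      2 ^ p * ∑ j ∈ Finset.range N, if l / 2 ^ j ≤ ψ x then (l / 2 ^ j) ^ p else 0 := fun x hx => by
    obtain ⟨h1, h2⟩ := hn x hx
    have hmem : n x ∈ Finset.range N :=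
      Finset.mem_range.2 (Nat.lt_succ_of_le (Finset.le_sup (f := n) hx))
    calc ψ x ^ p ≤ (2 * (l / 2 ^ n x)) ^ p := Real.rpow_le_rpow (hψ0 x) h2 (by linarith)
      _ = 2 ^ p * (l / 2 ^ n x) ^ p := Real.mul_rpow zero_le_two (hlj _).le
      _ ≤ _ := by
        refine mul_le_mul_of_nonneg_left ?_ (by positivity)
        refine le_of_eq_of_le ?_ (Finset.single_le_sum (f := fun j : ℕ =>
          if l / 2 ^ j ≤ ψ x then (l / 2 ^ j) ^ p else 0) (fun j _ => ?_) hmem)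
        · simp [h1]
        · have := hlj j
          split_ifs <;> positivity
  calc ∑' x, m x * |g x| * |φ x| ^ p = ∑ x ∈ S, m x * u x ^ p * |g x| * ψ x ^ p := by
        rw [tsum_eq_sum (s := S)]
        · refine Finset.sum_congr rfl fun x _ => ?_
          rw [← huψ, Real.mul_rpow (hu x).le (hψ0 x)]
          ring
        · intro x hx
          have h0 : ψ x = 0 := by simpa [hS] using hx
          rw [← huψ, h0, mul_zero, Real.zero_rpow (by linarith), mul_zero]
    _ ≤ ∑ x ∈ S, m x * u x ^ p * |g x| *
          (2 ^ p * ∑ j ∈ Finset.range N, if l / 2 ^ j ≤ ψ x then (l / 2 ^ j) ^ p else 0) :=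
        Finset.sum_le_sum fun x hx => mul_le_mul_of_nonneg_left (hlayer x hx) (by
          have := hm x; have := hu x; positivity)
    _ = 2 ^ p * ∑ j ∈ Finset.range N,
          (l / 2 ^ j) ^ p * ∑ x ∈ K j, m x * u x ^ p * |g x| := by
        simp only [Finset.mul_sum, hK, Finset.sum_filter]
        rw [Finset.sum_comm]
        refine Finset.sum_congr rfl fun j _ => Finset.sum_congr rfl fun x _ => ?_
        split_ifs
        · ring
        · simp
    _ ≤ 2 ^ p * ∑ j ∈ Finset.range N,
          A * energy p G c (fun x => u x * sqTrunc (l / 2 ^ j) (ψ x)) := by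
        refine mul_le_mul_of_nonneg_left (Finset.sum_le_sum fun j _ => ?_) (by positivity)
        calc (l / 2 ^ j) ^ p * ∑ x ∈ K j, m x * u x ^ p * |g x|
            ≤ (l / 2 ^ j) ^ p * (A * capacity p G c u (K j)) :=
              mul_le_mul_of_nonneg_left (hA _) (Real.rpow_nonneg (hlj j).le _)
          _ = A * ((l / 2 ^ j) ^ p * capacity p G c u (K j)) := by ring
          _ ≤ _ := mul_le_mul_of_nonneg_left (hcap j) hA0
    _ = 2 ^ p * A * ∑ j ∈ Finset.range N,
          energy p G c (fun x => u x * sqTrunc (l / 2 ^ j) (ψ x)) := by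
        rw [← Finset.mul_sum]; ring
    _ ≤ 2 ^ p * A * (6 * C * energy p G c (fun x => u x * ψ x)) := by
        gcongr
        exact sum_energy_sqTrunc_le hp hC0 hC hm hu hsup hψ hψ0 hl N
    _ ≤ 2 ^ p * A * (6 * C * energy p G c φ) := by
        simp only [huψ]
        gcongr
        exact energy_abs_le hp hφ
    _ = _ := by ring

lemma hardyNorm_le_mul_capacityNorm (hp : 1 < p) {C : ℝ} (hC0 : 1 ≤ C)
    (hC : ∀ a b z : ℝ, 0 ≤ a → 0 ≤ b → 0 ≤ z → z ≤ 1 →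
      piconeGap p a b 1 (z ^ 2) ≤ C * piconeGap p a b 1 z)
    (hm : ∀ x, 0 < m x) (hQ : EnergyNonneg p G c) (hu : ∀ x, 0 < u x)
    (hsup : IsSupersolution p G m c u) :
    hardyNorm p G m c g ≤
      ((2 ^ p * (6 * C)).toNNReal : ℝ≥0∞) * capacityNorm p G m c u g := by
  have hD : 0 < 2 ^ p * (6 * C) := by positivity
  rcases eq_or_ne (capacityNorm p G m c u g) ⊤ with htop | htop
  · rw [htop, ENNReal.mul_top (by simpa using hD)]
    exact le_top
  have hA : ∀ K : Finset X, ∑ x ∈ K, m x * u x ^ p * |g x| ≤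
      (capacityNorm p G m c u g).toReal * capacity p G c u K := fun K => by
    have hcap : 0 ≤ capacity p G c u K := le_capacity fun φ hφ _ => hQ φ hφ
    have h := le_iSup (fun K : Finset X => ENNReal.ofReal (∑ x ∈ K, m x * u x ^ p * |g x|) /
      ENNReal.ofReal (capacity p G c u K)) K
    change _ ≤ capacityNorm p G m c u g at h
    rw [ENNReal.div_le_iff_le_mul (Or.inr htop) (Or.inl ENNReal.ofReal_ne_top),
      ← ENNReal.ofReal_toReal htop, ← ENNReal.ofReal_mul ENNReal.toReal_nonneg] at h
    exact (ENNReal.ofReal_le_ofReal_iff (mul_nonneg ENNReal.toReal_nonneg hcap)).1 h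
  have hH := fun (φ : X → ℝ) (hφ : φ.support.Finite) =>
    hardy_of_capacity hp hC0 hC hm hQ hu hsup ENNReal.toReal_nonneg hA hφ
  rw [hardyNorm, ENNReal.inv_le_iff_inv_le]
  refine ENNReal.le_of_forall_nnreal_lt fun r hr => ?_
  refine le_iSup₂_of_le r (fun φ hφ => ?_) le_rfl
  have hr1 : (r : ℝ) * (2 ^ p * (6 * C) * (capacityNorm p G m c u g).toReal) ≤ 1 := by
    have h1 := ENNReal.mul_le_of_le_div (hr.le.trans_eq (one_div _).symm)
    have h2 := ENNReal.toReal_mono ENNReal.one_ne_top h1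
    simpa [ENNReal.toReal_mul, hD.le] using h2
  calc (r : ℝ) * ∑' x, m x * |g x| * |φ x| ^ p
      ≤ r * (2 ^ p * (6 * C) * (capacityNorm p G m c u g).toReal * energy p G c φ) :=
        mul_le_mul_of_nonneg_left (hH φ hφ) r.coe_nonneg
    _ = r * (2 ^ p * (6 * C) * (capacityNorm p G m c u g).toReal) * energy p G c φ := by ring
    _ ≤ energy p G c φ := mul_le_of_le_one_left (hQ φ hφ) hr1

end Capacity

end HardyGraph

theorem theorem3p1 (p : ℝ) (hp : 1 < p) :
    ∃ C : ℝ≥0, ∀ (X : Type*) [Countable X] [Infinite X]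
      (G : HardyGraph.ConnectedGraph X) (m : X → ℝ) (_ : ∀ x, 0 < m x) (c : X → ℝ)
      (_ : HardyGraph.EnergyNonneg p G c)
      (g u : X → ℝ) (_ : ∀ x, 0 < u x) (_ : HardyGraph.IsSupersolution p G m c u),
      HardyGraph.capacityNorm p G m c u g ≤ HardyGraph.hardyNorm p G m c g ∧
      HardyGraph.hardyNorm p G m c g ≤ (C : ℝ≥0∞) * HardyGraph.capacityNorm p G m c u g := by
  obtain ⟨C, hC0, hC⟩ := HardyGraph.exists_piconeGap_sq_bound hp
  exact ⟨(2 ^ p * (6 * C)).toNNReal, fun X _ _ G m hm c hQ g u hu hsup =>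
    ⟨HardyGraph.capacityNorm_le_hardyNorm hp hm hu,
      HardyGraph.hardyNorm_le_mul_capacityNorm hp hC0 hC hm hQ hu hsup⟩⟩
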